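/- **Theorem (uniform concentration).** Let $p,k,n$ be natural numbers with $n\ge 1$ and let $M$ be a real number. Let $\phi:\mathbb{R}^p\to\mathbb{R}$ be convex and differentiable, with Bregman divergence $d_\phi(x,y)=\phi(x)-\phi(y)-\langle\nabla\phi(y),x-y\rangle$. For every hyperparameter $\alpha$ in a set $\mathcal{A}\subseteq\mathbb{R}^q$ let $\Psi_\alpha:\mathbb{R}^k_{\ge 0}\to\mathbb{R}_{\ge 0}$ be componentwise non-decreasing with $\Psi_\alpha(\mathbf{0})=0$. Assume: - (A1) $X_1,\dots,X_n$ are independent random vectors in $\mathbb{R}^p$ with common distribution $P$, and $P([-M,M]^p)=1$; - (A2) for every $\alpha\in\mathcal{A}$ and all $x,y\in\mathbb{R}^k_{\ge 0}$, $|\Psi_\alpha(x)-\Psi_\alpha(y)|\le\tau_{\alpha,k}\|x-y\|_1$; - (A3) $H_p\ge 0$ and $\|\nabla\phi(x)-\nabla\phi(y)\|_2\le H_p\|x-y\|_2$ for all $x,y\in[-M,M]^p$. Fix $\alpha\in\mathcal{A}$ and $\delta\in(0,1]$. For $\Theta=(\theta_1,\dots,\theta_k)\in\mathbb{R}^{k\times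 p}$ put $f_\Theta(x)=\Psi_\alpha\big(d_\phi(x,\theta_1),\dots,d_\phi(x,\theta_k)\big)$, let $\mathcal{F}=\{f_\Theta:\Theta\in[-M,M]^{k\times p}\}$, and let $P_n=\frac1n\sum_{i=1}^n\delta_{X_i}$ be the empirical distribution. Write $\mu f=\int f\,d\mu$. Then every $f\in\mathcal{F}$ is $P$-integrable, and with probability at least $1-\delta$, $$\sup_{f\in\mathcal{F}}|P_nf-Pf|\;\le\;96\sqrt{\pi}\,\tau_{\alpha,k}H_pM^2(kp)^{3/2}n^{-1/2}+4\,\tau_{\alpha,k}H_pM^2pk\sqrt{\frac{\log(2/\delta)}{2n}}.$$ -/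

import Mathlib

open MeasureTheory ProbabilityTheory
open scoped ENNReal

noncomputable section

namespace CenterClustering

/-- The cube `[-M, M]^p` in Euclidean space `ℝ^p`. -/
def cube (p : ℕ) (M : ℝ) : Set (EuclideanSpace ℝ (Fin p)) :=
  {x | ∀ i, x i ∈ Set.Icc (-M) M}

/-- The probability measures on `ℝ^p` that give mass one to the cube `[-M, M]^p`. -/
def cubeMeasures (p : ℕ) (M : ℝ) : Set (Measure (EuclideanSpace ℝ (Fin p))) :=
  {P | IsProbabilityMeasure P ∧ P (cube p M) = 1}

/-- The Bregman divergence `d_φ(x, y) = φ(x) - φ(y) - ⟨∇φ(y), x - y⟩`. -/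
def bregman {p : ℕ} (φ : EuclideanSpace ℝ (Fin p) → ℝ) (x y : EuclideanSpace ℝ (Fin p)) : ℝ :=
  φ x - φ y - inner ℝ (gradient φ y) (x - y)

/-- The loss `f_Θ(x) = Ψ(d_φ(x, θ₁), …, d_φ(x, θ_k))` of the centroids `Θ = (θ₁, …, θ_k)`. -/
def loss {p k : ℕ} (φ : EuclideanSpace ℝ (Fin p) → ℝ) (Ψ : (Fin k → ℝ) → ℝ)
    (Θ : Fin k → EuclideanSpace ℝ (Fin p)) (x : EuclideanSpace ℝ (Fin p)) : ℝ :=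
  Ψ (fun j => bregman φ x (Θ j))

/-- The class `F = {f_Θ : Θ ∈ [-M, M]^{k × p}}`. -/
def lossClass {p k : ℕ} (φ : EuclideanSpace ℝ (Fin p) → ℝ) (Ψ : (Fin k → ℝ) → ℝ) (M : ℝ) :
    Set (EuclideanSpace ℝ (Fin p) → ℝ) :=
  {f | ∃ Θ : Fin k → EuclideanSpace ℝ (Fin p), (∀ j, Θ j ∈ cube p M) ∧ f = loss φ Ψ Θ}

/-- The empirical distribution `(1/n) ∑ᵢ δ_{xᵢ}` of the points `x₁, …, x_n`. -/
def empirical {E : Type*} [MeasurableSpace E] {n : ℕ} (x : Fin n → E) : Measure E :=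
  (n : ℝ≥0∞)⁻¹ • ∑ i, Measure.dirac (x i)

/-- The distance `‖μ - ν‖_F = sup_{f ∈ F} |∫ f dμ - ∫ f dν|`, as an extended non-negative real
(so that the supremum is a genuine one even when it is infinite). -/
def classDist {E : Type*} [MeasurableSpace E] (F : Set (E → ℝ)) (μ ν : Measure E) : ℝ≥0∞ :=
  ⨆ f ∈ F, ENNReal.ofReal |(∫ x, f x ∂μ) - ∫ x, f x ∂ν|

/-- Standing assumptions on an aggregating function `Ψ : ℝ^k_{≥0} → ℝ_{≥0}`: it is non-negative and
componentwise non-decreasing on the non-negative orthant, and it vanishes at the origin.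
Values of `Ψ` off the non-negative orthant are irrelevant. -/
structure IsAggregator {k : ℕ} (Ψ : (Fin k → ℝ) → ℝ) : Prop where
  nonneg : ∀ x, 0 ≤ x → 0 ≤ Ψ x
  mono : ∀ x y, 0 ≤ x → x ≤ y → Ψ x ≤ Ψ y
  map_zero : Ψ 0 = 0

end CenterClustering

end

namespace CenterClustering

/-! Put `B = 4τHM²pk` and write the centroids as `M • u` with `u` in the unit cube of dimension `D =
kp`. On the data cube the loss lies in `[0, 3B/4]` and is `B`-Lipschitz in `u` for the sup norm.
Both facts follow from the three-points identity for Bregman divergences and the Lipschitz gradient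
(`loss_mem_Icc`, `abs_loss_sub_le`).

The supremum over `u` is then bounded by dyadic chaining, with Hoeffding's inequality and a union
bound at each scale (`exists_uniform_deviation_le`). The chain starts at level 3, with half-range
`3B/8`; the links into levels 4, 5, … have half-ranges `B/16, B/32, …`, of sum `B/8`. The
half-ranges therefore add up to `B/2`, exactly the coefficient of `√(2 log(2/δ)/n)` that the
confidence term allows. The net sizes only contribute a multiple of `B√(D/n)`, which is far below
the first term of the claim (`chaining_bound_le`). -/

/-- The deviation `(1/n) ∑ᵢ g(xᵢ) - ∫ g dP` of the sample mean of `g` from its expectation. -/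
noncomputable def deviation {E : Type*} [MeasurableSpace E] {n : ℕ} (P : Measure E) (x : Fin n → E)
    (g : E → ℝ) : ℝ :=
  (n : ℝ)⁻¹ * ∑ i, g (x i) - ∫ y, g y ∂P

/-! ### Deviations of sample means and Hoeffding's inequality. -/

section Deviation

variable {E : Type*} [MeasurableSpace E] {n : ℕ}

lemma deviation_sub {P : Measure E} {x : Fin n → E} {f g : E → ℝ} (hf : Integrable f P)
    (hg : Integrable g P) :
    deviation P x (f - g) = deviation P x f - deviation P x g := by
  simp only [deviation, Pi.sub_apply, Finset.sum_sub_distrib, integral_sub hf hg]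
  ring

lemma deviation_eq_sum (hn : 0 < n) (P : Measure E) (x : Fin n → E) (g : E → ℝ) :
    deviation P x g = (n : ℝ)⁻¹ * ∑ i, (g (x i) - ∫ y, g y ∂P) := by
  have : (n : ℝ) ≠ 0 := by positivity
  simp only [deviation, Finset.sum_sub_distrib, Finset.sum_const, Finset.card_univ,
    Fintype.card_fin, nsmul_eq_mul]
  field_simp

/-- A function bounded by `s` deviates by at most `2 * s`. -/
lemma abs_deviation_le (hn : 0 < n) {P : Measure E} [IsProbabilityMeasure P] (x : Fin n → E)
    {g : E → ℝ} {s : ℝ} (hs : ∀ y, |g y| ≤ s) :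
    |deviation P x g| ≤ 2 * s := by
  have hn' : (0 : ℝ) < n := by positivity
  have h1 : |∫ y, g y ∂P| ≤ s := by
    have := norm_integral_le_of_norm_le_const (μ := P) (f := g) (C := s)
      (Filter.Eventually.of_forall fun y => by simpa using hs y)
    simpa using this
  have h2 : |(n : ℝ)⁻¹ * ∑ i, g (x i)| ≤ s := by
    rw [abs_mul, abs_of_pos (inv_pos.2 hn'), inv_mul_le_iff₀ hn']
    calc |∑ i, g (x i)| ≤ ∑ i, |g (x i)| := Finset.abs_sum_le_sum_abs _ _
      _ ≤ ∑ _i : Fin n, s := Finset.sum_le_sum fun i _ => hs _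
      _ = n * s := by simp
  calc |deviation P x g| ≤ |(n : ℝ)⁻¹ * ∑ i, g (x i)| + |∫ y, g y ∂P| := abs_sub _ _
    _ ≤ 2 * s := by linarith

variable {Ω : Type*} [MeasurableSpace Ω] {μ : Measure Ω} [IsProbabilityMeasure μ]
  {P : Measure E} {X : Fin n → Ω → E}

lemma measure_deviation_ge_le (hn : 0 < n) (hXm : ∀ i, Measurable (X i)) (hXind : iIndepFun X μ)
    (hXlaw : ∀ i, μ.map (X i) = P) {g : E → ℝ} (hg : Measurable g) {a s : ℝ} (hs : 0 < s)
    (hgs : ∀ y, g y ∈ Set.Icc a (a + 2 * s)) {L : ℝ} (hL : 0 ≤ L) :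
    μ.real {ω | s * Real.sqrt (2 * L / n) ≤ deviation P (fun i => X i ω) g} ≤ Real.exp (-L) := by
  have hn' : (0 : ℝ) < n := by positivity
  have hint (i : Fin n) : ∫ ω, g (X i ω) ∂μ = ∫ y, g y ∂P := by
    rw [← hXlaw i, integral_map (hXm i).aemeasurable hg.aestronglyMeasurable]
  have hsub (i : Fin n) :
      HasSubgaussianMGF (fun ω => g (X i ω) - ∫ y, g y ∂P) (Real.toNNReal (s ^ 2)) μ := by
    have h := hasSubgaussianMGF_of_mem_Icc (μ := μ) (X := fun ω => g (X i ω))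
      (hg.comp (hXm i)).aemeasurable (Filter.Eventually.of_forall fun ω => hgs (X i ω))
    rw [hint i] at h
    convert h using 1
    ext
    simp [abs_of_pos hs]
    positivity
  have hind : iIndepFun (fun i ω => g (X i ω) - ∫ y, g y ∂P) μ :=
    hXind.comp (fun _ y => g y - ∫ y, g y ∂P) fun _ => hg.sub_const _
  have h := HasSubgaussianMGF.measure_sum_ge_le_of_iIndepFun hind (s := Finset.univ)
    (fun i _ => hsub i) (ε := n * (s * Real.sqrt (2 * L / n))) (by positivity)
  refine le_trans (le_of_eq ?_) (h.trans (le_of_eq ?_))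
  · congr 1
    ext ω
    simp only [Set.mem_ofPred_eq]
    rw [deviation_eq_sum hn, le_inv_mul_iff₀ hn']
  · congr 1
    simp only [Finset.sum_const, Finset.card_univ, Fintype.card_fin, nsmul_eq_mul,
      NNReal.coe_mul, NNReal.coe_natCast, Real.coe_toNNReal _ (sq_nonneg s)]
    rw [mul_pow, mul_pow, Real.sq_sqrt (by positivity)]
    field_simp

/-- **Hoeffding's inequality**, two-sided, including the degenerate case of a constant function. -/
lemma measure_abs_deviation_gt_le (hn : 0 < n) (hXm : ∀ i, Measurable (X i))
    (hXind : iIndepFun X μ) (hXlaw : ∀ i, μ.map (X i) = P) {g : E → ℝ} (hg : Measurable g)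
    {a s : ℝ} (hs : 0 ≤ s) (hgs : ∀ y, g y ∈ Set.Icc a (a + 2 * s)) {L : ℝ} (hL : 0 ≤ L) :
    μ.real {ω | s * Real.sqrt (2 * L / n) < |deviation P (fun i => X i ω) g|}
      ≤ 2 * Real.exp (-L) := by
  have hP : IsProbabilityMeasure P :=
    hXlaw ⟨0, hn⟩ ▸ Measure.isProbabilityMeasure_map (hXm _).aemeasurable
  -- For `s = 0` the closed one-sided events have full measure, whereas the strict two-sided event
  -- is empty because `g` is constant.
  rcases hs.eq_or_lt with rfl | hs
  · have hg' : g = fun _ => a := by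
      ext y
      have := hgs y
      simp at this
      exact this
    have hn' : (n : ℝ) ≠ 0 := by positivity
    have : ∀ ω, deviation P (fun i => X i ω) g = 0 := fun ω => by
      rw [deviation_eq_sum hn, hg']
      simp
    simp [this]
    positivity
  · have h1 := measure_deviation_ge_le hn hXm hXind hXlaw hg hs hgs hL
    have h2 := measure_deviation_ge_le hn hXm hXind hXlaw (g := fun y => -g y) hg.neg
      (a := -(a + 2 * s)) hs (fun y => ⟨by linarith [(hgs y).2], by linarith [(hgs y).1]⟩) hL
    calc _ ≤ μ.real ({ω | s * Real.sqrt (2 * L / n) ≤ deviation P (fun i => X i ω) g} ∪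
            {ω | s * Real.sqrt (2 * L / n) ≤ deviation P (fun i => X i ω) (fun y => -g y)}) := by
          refine measureReal_mono fun ω hω => ?_
          rcases lt_abs.1 (Set.mem_ofPred_eq ▸ hω) with h | h
          · exact Or.inl h.le
          · refine Or.inr (h.le.trans (le_of_eq ?_))
            simp only [deviation, Finset.sum_neg_distrib, integral_neg]
            ring
      _ ≤ _ := measureReal_union_le _ _
      _ ≤ 2 * Real.exp (-L) := by linarith

end Deviation

/-! ### Dyadic nets of the cube `[-1, 1]^ι` -/

section Net

variable {ι : Type*}

/-- The vector with entries `1` where `e` is true and `-1` elsewhere. -/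
def signVec (e : ι → Bool) : ι → ℝ := fun i => if e i then 1 else -1

/-- The child in direction `e`, at dyadic level `j + 1`, of the point `s` of level `j`. -/
noncomputable def child (j : ℕ) (s : ι → ℝ) (e : ι → Bool) : ι → ℝ :=
  fun i => s i + (1 / 2) ^ (j + 1) * signVec e i

lemma abs_signVec (e : ι → Bool) (i : ι) : |signVec e i| = 1 := by
  unfold signVec; split_ifs <;> simp

lemma abs_child_sub (j : ℕ) (s : ι → ℝ) (e : ι → Bool) (i : ι) :
    |child j s e i - s i| = (1 / 2) ^ (j + 1) := by
  rw [child, add_sub_cancel_left, abs_mul, abs_signVec, mul_one, abs_of_pos (by positivity)]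

/-- The dyadic approximations of a point. -/
noncomputable def approx (u : ι → ℝ) : ℕ → ι → ℝ
  | 0 => 0
  | j + 1 => child j (approx u j) fun i => decide (approx u j i ≤ u i)

/-- Bisection: a step of length `r` towards a target at distance at most `2r` leaves an error of at
most `r`. -/
lemma abs_sub_approx_le {u : ι → ℝ} (hu : ∀ i, |u i| ≤ 1) (j : ℕ) (i : ι) :
    |u i - approx u j i| ≤ (1 / 2) ^ j := by
  induction j with
  | zero => simpa [approx] using hu i
  | succ j ih =>
    have : ((1 : ℝ) / 2) ^ j = 2 * (1 / 2) ^ (j + 1) := by ring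
    rw [this, abs_le] at ih
    simp only [approx, child, signVec, decide_eq_true_eq]
    rw [abs_le]
    split_ifs with h
    · constructor <;> linarith [ih.1, ih.2]
    · constructor <;> linarith [ih.1, ih.2]

variable [Fintype ι] [DecidableEq ι]

open Classical in
/-- The centres of the `2 ^ (j * card ι)` dyadic subcubes of level `j` of the cube `[-1, 1]^ι`. -/
noncomputable def dyadicNet (ι : Type*) [Fintype ι] [DecidableEq ι] : ℕ → Finset (ι → ℝ)
  | 0 => {0}
  | j + 1 => (dyadicNet ι j ×ˢ Finset.univ).image fun z : (ι → ℝ) × (ι → Bool) => child j z.1 z.2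

lemma child_mem_dyadicNet {j : ℕ} {s : ι → ℝ} (hs : s ∈ dyadicNet ι j) (e : ι → Bool) :
    child j s e ∈ dyadicNet ι (j + 1) := by
  simp only [dyadicNet, Finset.mem_image, Finset.mem_product, Finset.mem_univ, and_true,
    Prod.exists]
  exact ⟨s, e, hs, rfl⟩

lemma card_dyadicNet_le (j : ℕ) : (dyadicNet ι j).card ≤ 2 ^ (j * Fintype.card ι) := by
  induction j with
  | zero => simp [dyadicNet]
  | succ j ih =>
    rw [dyadicNet]
    refine Finset.card_image_le.trans ?_
    rw [Finset.card_product, Finset.card_univ, Fintype.card_fun, Fintype.card_bool, add_mul,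
      one_mul, pow_add]
    gcongr

/-- The steps from the origin add up to `1/2 + ⋯ + 2⁻ʲ = 1 - 2⁻ʲ`. Hence the nets stay in the cube,
where the bounds on the class are available. -/
lemma abs_le_of_mem_dyadicNet {j : ℕ} {s : ι → ℝ} (hs : s ∈ dyadicNet ι j) (i : ι) :
    |s i| ≤ 1 - (1 / 2) ^ j := by
  induction j generalizing s with
  | zero => simp [dyadicNet] at hs; simp [hs]
  | succ j ih =>
    simp only [dyadicNet, Finset.mem_image, Finset.mem_product, Finset.mem_univ, and_true,
      Prod.exists] at hs
    obtain ⟨t, e, ht, rfl⟩ := hs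
    have h1 := ih ht
    have h2 := abs_child_sub j t e i
    have h3 := abs_sub_abs_le_abs_sub (child j t e i) (t i)
    have : ((1 : ℝ) / 2) ^ j = 2 * (1 / 2) ^ (j + 1) := by ring
    linarith

lemma mem_Icc_of_mem_dyadicNet {j : ℕ} {s : ι → ℝ} (hs : s ∈ dyadicNet ι j) (i : ι) :
    |s i| ≤ 1 := by
  have := abs_le_of_mem_dyadicNet hs i
  have : (0 : ℝ) < (1 / 2) ^ j := by positivity
  linarith

lemma approx_mem_dyadicNet (u : ι → ℝ) (j : ℕ) : approx u j ∈ dyadicNet ι j := by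
  induction j with
  | zero => simp [approx, dyadicNet]
  | succ j ih => exact child_mem_dyadicNet ih _

end Net

/-! ### Chaining along the dyadic nets. -/

/-- Allocation of the failure probability: the extra exponent `2jD` beats the `2 ^ (jD)` events of
level `j`, since `2e⁻² ≤ 1/2`, and leaves a summable share of `δ`. -/
lemma two_mul_exp_neg_mul_le {δ : ℝ} (hδ : 0 < δ) {D : ℕ} (hD : 0 < D) (j : ℕ) :
    2 * Real.exp (-(Real.log (2 / δ) + 2 * j * D)) * 2 ^ (j * D) ≤ δ * (1 / 2) ^ j := by
  have h1 : Real.exp (-Real.log (2 / δ)) = δ / 2 := by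
    rw [Real.exp_neg, Real.exp_log (by positivity), inv_div]
  have h2 : Real.exp (-2) ≤ 1 / 4 := by
    have h := Real.add_one_le_exp (1 : ℝ)
    have h' : Real.exp 2 = Real.exp 1 * Real.exp 1 := by rw [← Real.exp_add]; norm_num
    rw [Real.exp_neg, inv_le_comm₀ (Real.exp_pos _) (by norm_num), h']
    nlinarith
  have h3 : Real.exp (-(2 * j * D)) = Real.exp (-2) ^ (j * D) := by
    rw [← Real.exp_nat_mul]; congr 1; push_cast; ring
  calc _ = δ * (Real.exp (-2) * 2) ^ (j * D) := by
        rw [neg_add, Real.exp_add, h1, h3, mul_pow]; ring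
    _ ≤ δ * (1 / 2) ^ (j * D) := by
        have : Real.exp (-2) * 2 ≤ 1 / 2 := by linarith
        gcongr
    _ ≤ δ * (1 / 2) ^ j := by
        gcongr ?_ * ?_
        exact pow_le_pow_of_le_one (by norm_num) (by norm_num) (Nat.le_mul_of_pos_right _ hD)

/-- Subadditivity of the root, with `√j` weakened to `j` so that the sum over the levels has a
closed form. -/
lemma sqrt_level_le {l n D : ℝ} (hl : 0 ≤ l) (hn : 0 < n) (hD : 0 ≤ D) (j : ℕ) :
    Real.sqrt (2 * (l + 2 * j * D) / n) ≤ Real.sqrt (2 * l / n) + 2 * j * Real.sqrt (D / n) := by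
  rw [Real.sqrt_le_iff]
  refine ⟨by positivity, ?_⟩
  have h1 : Real.sqrt (2 * l / n) ^ 2 = 2 * l / n := Real.sq_sqrt (by positivity)
  have h2 : Real.sqrt (D / n) ^ 2 = D / n := Real.sq_sqrt (by positivity)
  have h3 : (j : ℝ) ≤ (j : ℝ) ^ 2 := by exact_mod_cast Nat.le_self_pow two_ne_zero j
  have h4 : 0 ≤ Real.sqrt (2 * l / n) * (2 * j * Real.sqrt (D / n)) := by positivity
  calc 2 * (l + 2 * j * D) / n = 2 * l / n + 4 * j * (D / n) := by ring
    _ ≤ 2 * l / n + 4 * (j : ℝ) ^ 2 * (D / n) := by gcongr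
    _ ≤ _ := by rw [add_sq, h1, mul_pow, h2]; linarith

variable {E : Type*} [MeasurableSpace E] {n : ℕ} {Ω : Type*} [MeasurableSpace Ω]
  {μ : Measure Ω} [IsProbabilityMeasure μ] {P : Measure E} {X : Fin n → Ω → E}

/-- Hoeffding's inequality with a union bound over a finite family of functions. -/
lemma measure_exists_deviation_gt_le (hn : 0 < n) (hXm : ∀ i, Measurable (X i))
    (hXind : iIndepFun X μ) (hXlaw : ∀ i, μ.map (X i) = P) {κ : Type*} (N : Finset κ)
    {g : κ → E → ℝ} (hg : ∀ z ∈ N, Measurable (g z)) {a s : ℝ} (hs : 0 ≤ s)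
    (hgs : ∀ z ∈ N, ∀ y, g z y ∈ Set.Icc a (a + 2 * s)) {δ : ℝ} (hδ0 : 0 < δ) (hδ1 : δ ≤ 1)
    {D : ℕ} (hD : 0 < D) (j : ℕ) (hN : N.card ≤ 2 ^ (j * D)) :
    μ (⋃ z ∈ N, {ω | s * Real.sqrt (2 * (Real.log (2 / δ) + 2 * j * D) / n) <
        |deviation P (fun i => X i ω) (g z)|}) ≤ ENNReal.ofReal (δ * (1 / 2) ^ j) := by
  have hl : 0 ≤ Real.log (2 / δ) := Real.log_nonneg (by rw [le_div_iff₀ hδ0]; linarith)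
  refine (measure_biUnion_finset_le N _).trans ?_
  calc _ ≤ ∑ _z ∈ N, ENNReal.ofReal (2 * Real.exp (-(Real.log (2 / δ) + 2 * j * D))) := by
        refine Finset.sum_le_sum fun z hz => ?_
        rw [← ENNReal.ofReal_toReal (measure_ne_top μ _)]
        exact ENNReal.ofReal_le_ofReal (measure_abs_deviation_gt_le hn hXm hXind hXlaw (hg z hz) hs
          (hgs z hz) (by positivity))
    _ = ENNReal.ofReal (N.card * (2 * Real.exp (-(Real.log (2 / δ) + 2 * j * D)))) := by
        rw [Finset.sum_const, nsmul_eq_mul, ENNReal.ofReal_mul (Nat.cast_nonneg _),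
          ENNReal.ofReal_natCast]
    _ ≤ _ := by
        refine ENNReal.ofReal_le_ofReal (le_trans ?_ (two_mul_exp_neg_mul_le hδ0 hD j))
        rw [mul_comm]
        gcongr
        exact_mod_cast hN

/-- **Chaining.** A uniform deviation bound for a class of bounded functions that is parametrized
in a Lipschitz way by the cube `[-1, 1]^ι`. -/
theorem exists_uniform_deviation_le {ι : Type*} [Fintype ι] [Nonempty ι] (hn : 0 < n)
    (hXm : ∀ i, Measurable (X i)) (hXind : iIndepFun X μ) (hXlaw : ∀ i, μ.map (X i) = P)
    {F : (ι → ℝ) → E → ℝ} {B : ℝ} (hB : 0 ≤ B) (hFm : ∀ u, Measurable (F u))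
    (hFB : ∀ u, (∀ i, |u i| ≤ 1) → ∀ y, F u y ∈ Set.Icc 0 (3 / 4 * B))
    (hFL : ∀ u v, (∀ i, |u i| ≤ 1) → (∀ i, |v i| ≤ 1) → ∀ r, (∀ i, |u i - v i| ≤ r) →
      ∀ y, |F u y - F v y| ≤ B * r)
    {δ : ℝ} (hδ0 : 0 < δ) (hδ1 : δ ≤ 1) :
    ∃ bad : Set Ω, μ bad ≤ ENNReal.ofReal δ ∧ ∀ ω ∉ bad, ∀ u, (∀ i, |u i| ≤ 1) →
      |deviation P (fun i => X i ω) (F u)| ≤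
        4 * B * Real.sqrt (Fintype.card ι / n) + B * Real.sqrt (Real.log (2 / δ) / (2 * n)) := by
  classical
  have hP : IsProbabilityMeasure P :=
    hXlaw ⟨0, hn⟩ ▸ Measure.isProbabilityMeasure_map (hXm _).aemeasurable
  have hn' : (0 : ℝ) < n := by positivity
  have hl : 0 ≤ Real.log (2 / δ) := Real.log_nonneg (by rw [le_div_iff₀ hδ0]; linarith)
  set l := Real.log (2 / δ) with hl_def
  set D := Fintype.card ι with hD_def
  have hD : 0 < D := Fintype.card_pos
  let S : ℕ → ℝ := fun j => Real.sqrt (2 * (l + 2 * j * D) / n)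
  -- Starting at level 3 makes the remaining links cost only `B/8`, the room left by the half-range
  -- `3B/8` below `B/2`.
  let base : Set Ω := ⋃ s ∈ dyadicNet ι 3, {ω | 3 / 8 * B * S 3 <
    |deviation P (fun i => X i ω) (F s)|}
  let link : ℕ → Set Ω := fun j => ⋃ z ∈ dyadicNet ι j ×ˢ (Finset.univ : Finset (ι → Bool)),
    {ω | B * (1 / 2) ^ (j + 1) * S (j + 1) <
      |deviation P (fun i => X i ω) (F (child j z.1 z.2) - F z.1)|}
  have hbase : μ base ≤ ENNReal.ofReal (δ * (1 / 2) ^ 3) :=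
    measure_exists_deviation_gt_le hn hXm hXind hXlaw _ (fun z _ => hFm z)
      (a := 0) (by positivity) (fun z hz y => by
        convert hFB z (mem_Icc_of_mem_dyadicNet hz) y using 2; ring) hδ0 hδ1 hD 3
      (card_dyadicNet_le 3)
  have hlink (j : ℕ) : μ (link j) ≤ ENNReal.ofReal (δ * (1 / 2) ^ (j + 1)) := by
    refine measure_exists_deviation_gt_le hn hXm hXind hXlaw _
      (g := fun z : (ι → ℝ) × (ι → Bool) => F (child j z.1 z.2) - F z.1)
      (fun z _ => (hFm _).sub (hFm _)) (a := -(B * (1 / 2) ^ (j + 1))) (by positivity)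
      (fun z hz y => ?_) hδ0 hδ1 hD (j + 1) ?_
    · have hz' := (Finset.mem_product.1 hz).1
      have h := hFL _ _ (mem_Icc_of_mem_dyadicNet (child_mem_dyadicNet hz' z.2))
        (mem_Icc_of_mem_dyadicNet hz') _ (fun i => (abs_child_sub j z.1 z.2 i).le) y
      rw [abs_le] at h
      exact ⟨h.1, by simpa [two_mul] using h.2⟩
    · rw [Finset.card_product, Finset.card_univ, Fintype.card_fun, Fintype.card_bool, add_mul,
        one_mul, pow_add]
      exact Nat.mul_le_mul_right _ (card_dyadicNet_le j)
  refine ⟨base ∪ ⋃ j, link (j + 3), ?_, fun ω hω u hu => ?_⟩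
  · calc _ ≤ μ base + μ (⋃ j, link (j + 3)) := measure_union_le _ _
      _ ≤ ENNReal.ofReal (δ * (1 / 2) ^ 3) +
            ∑' j : ℕ, ENNReal.ofReal (δ * (1 / 2) ^ 4 * (1 / 2) ^ j) := by
          refine add_le_add hbase ((measure_iUnion_le _).trans (ENNReal.tsum_le_tsum fun j => ?_))
          refine (hlink (j + 3)).trans (le_of_eq ?_)
          congr 1; ring
      -- The starting net and all the links together cost `δ/8` each.
      _ = ENNReal.ofReal (δ * (1 / 2) ^ 3 + δ * (1 / 2) ^ 4 * 2) := by
          rw [← ENNReal.ofReal_tsum_of_nonneg (fun j => by positivity)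
            (summable_geometric_two.mul_left _), tsum_mul_left, tsum_geometric_two,
            ENNReal.ofReal_add (by positivity) (by positivity)]
      _ ≤ ENNReal.ofReal δ := ENNReal.ofReal_le_ofReal (by linarith)
  · simp only [Set.mem_union, not_or, Set.mem_iUnion, not_exists, base, link,
      Set.mem_ofPred_eq, not_lt] at hω
    obtain ⟨hω0, hω1⟩ := hω
    set x : Fin n → E := fun i => X i ω
    have hint {v : ι → ℝ} (hv : ∀ i, |v i| ≤ 1) : Integrable (F v) P :=
      Integrable.of_mem_Icc 0 (3 / 4 * B) (hFm v).aemeasurable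
        (Filter.Eventually.of_forall (hFB v hv))
    have hap (j : ℕ) := mem_Icc_of_mem_dyadicNet (approx_mem_dyadicNet u j)
    set a := Real.sqrt (2 * l / n)
    set c := Real.sqrt (D / n)
    have hS (j : ℕ) : S j ≤ a + 2 * j * c := sqrt_level_le hl hn' (by positivity) j
    -- Partial sums at level `J = m + 3`. The coefficient of `B * a` is `3/8 + ∑ 2⁻ⁱ` over `4 ≤ i ≤
    -- J`; that of `B * c` grows by exactly `2i · 2⁻ⁱ` at level `i`, and its initial value `11/4`
    -- exceeds the required `9/4`.
    have hstep (m : ℕ) : |deviation P x (F (approx u (m + 3)))| ≤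
        B * a * (1 / 2 - (1 / 2) ^ (m + 3)) + B * c * (4 - (2 * (m + 3) + 4) * (1 / 2) ^ (m + 3)) := by
      induction m with
      | zero =>
        have h := (hω0 _ (approx_mem_dyadicNet u 3)).trans
          (mul_le_mul_of_nonneg_left (hS 3) (by positivity))
        have hc : 0 ≤ B * c := by positivity
        norm_num at h ⊢
        linarith
      | succ m ih =>
        have h := (hω1 m (approx u (m + 3), fun i => decide (approx u (m + 3) i ≤ u i))
          (by simpa using approx_mem_dyadicNet u (m + 3))).trans
          (mul_le_mul_of_nonneg_left (hS (m + 3 + 1)) (by positivity))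
        change |deviation P x (F (approx u (m + 3 + 1)) - F (approx u (m + 3)))| ≤ _ at h
        rw [deviation_sub (hint (hap _)) (hint (hap _))] at h
        have h' := abs_sub_abs_le_abs_sub (deviation P x (F (approx u (m + 3 + 1))))
          (deviation P x (F (approx u (m + 3))))
        rw [show m + 1 + 3 = m + 3 + 1 by ring]
        have hp : ((1 : ℝ) / 2) ^ (m + 3) = 2 * (1 / 2) ^ (m + 3 + 1) := by ring
        rw [hp] at ih
        push_cast at h ⊢
        linarith
    -- The end of the chain is deterministic: the uniform distance from `F u` to its approximation
    -- tends to zero.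
    have hlim (m : ℕ) : |deviation P x (F u)| ≤ B * a * (1 / 2) + B * c * 4 +
        2 * B * (1 / 2) ^ (m + 3) := by
      have h1 : |deviation P x (F u - F (approx u (m + 3)))| ≤ 2 * (B * (1 / 2) ^ (m + 3)) :=
        abs_deviation_le hn x fun y => hFL _ _ hu (hap _) _ (abs_sub_approx_le hu _) y
      rw [deviation_sub (hint hu) (hint (hap _))] at h1
      have h2 := abs_sub_abs_le_abs_sub (deviation P x (F u))
          (deviation P x (F (approx u (m + 3))))
      have h3 := hstep m
      have h4 : 0 ≤ B * a * (1 / 2) ^ (m + 3) := by positivity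
      have h5 : 0 ≤ B * c * ((2 * (m + 3) + 4) * (1 / 2) ^ (m + 3)) := by positivity
      linarith
    have htend : Filter.Tendsto (fun m : ℕ => B * a * (1 / 2) + B * c * 4 +
        2 * B * (1 / 2 : ℝ) ^ (m + 3)) Filter.atTop (nhds (B * a * (1 / 2) + B * c * 4 +
        2 * B * 0)) := by
      refine Filter.Tendsto.const_add _ (Filter.Tendsto.const_mul _ ?_)
      exact (Filter.tendsto_add_atTop_iff_nat 3).2
        (tendsto_pow_atTop_nhds_zero_of_lt_one (by norm_num) (by norm_num))
    have h := ge_of_tendsto' htend hlim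
    have ha : a = 2 * Real.sqrt (l / (2 * n)) := by
      rw [← Real.sqrt_sq (show (0 : ℝ) ≤ 2 by norm_num), ← Real.sqrt_mul (by positivity)]
      exact congrArg Real.sqrt (by field_simp; ring)
    rw [ha] at h
    linarith

/-! ### Bregman divergences with a Lipschitz gradient on the cube. -/

section Bregman

variable {p : ℕ} {φ : EuclideanSpace ℝ (Fin p) → ℝ}

/-- The first-order condition for convexity. -/
lemma bregman_nonneg (hφd : Differentiable ℝ φ) (hφc : ConvexOn ℝ Set.univ φ)
    (x y : EuclideanSpace ℝ (Fin p)) : 0 ≤ bregman φ x y := by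
  have hline : HasDerivAt (fun t : ℝ => y + t • (x - y)) (x - y) 0 := by
    simpa using ((hasDerivAt_id (0 : ℝ)).smul_const (x - y)).const_add y
  have hcomp : HasDerivAt (fun t : ℝ => φ (y + t • (x - y))) (inner ℝ (gradient φ y) (x - y)) 0 := by
    rw [inner_gradient_left]
    have h : HasFDerivAt φ (fderiv ℝ φ y) (y + (0 : ℝ) • (x - y)) := by
      simpa using (hφd y).hasFDerivAt
    exact h.comp_hasDerivAt (0 : ℝ) hline
  have hconv : ConvexOn ℝ Set.univ (fun t : ℝ => φ (y + t • (x - y))) := by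
    have h := hφc.comp_affineMap (AffineMap.lineMap y x : ℝ →ᵃ[ℝ] EuclideanSpace ℝ (Fin p))
    have e : (fun t : ℝ => φ (y + t • (x - y))) = φ ∘ AffineMap.lineMap y x := by
      ext t
      simp [AffineMap.lineMap_apply, add_comm]
    rw [e]
    exact h
  have h := hconv.le_slope_of_hasDerivAt (Set.mem_univ 0) (Set.mem_univ 1) one_pos hcomp
  rw [slope_def_field, one_smul, zero_smul, add_zero, add_sub_cancel, sub_zero, div_one] at h
  unfold bregman
  linarith

/-- The failure of additivity is a gradient difference, which the Lipschitz condition controls. -/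
lemma bregman_three_points (x y z : EuclideanSpace ℝ (Fin p)) :
    bregman φ x z = bregman φ x y + bregman φ y z +
      inner ℝ (gradient φ y - gradient φ z) (x - y) := by
  have : x - z = (x - y) + (y - z) := by abel
  simp only [bregman, this, inner_sub_left, inner_add_right]
  ring

lemma bregman_add_bregman_comm (x y : EuclideanSpace ℝ (Fin p)) :
    bregman φ x y + bregman φ y x = inner ℝ (gradient φ x - gradient φ y) (x - y) := by
  have : y - x = -(x - y) := by abel
  simp only [bregman, this, inner_neg_right, inner_sub_left]
  ring

lemma convex_cube (M : ℝ) : Convex ℝ (cube p M) := by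
  intro x hx y hy a b ha hb hab i
  exact (convex_Icc (-M) M) (hx i) (hy i) ha hb hab

lemma isClosed_cube (M : ℝ) : IsClosed (cube p M) := by
  have : cube p M = ⋂ i, (fun x : EuclideanSpace ℝ (Fin p) => x i) ⁻¹' Set.Icc (-M) M := by
    ext x
    simp only [cube, Set.mem_iInter, Set.mem_preimage]
    rfl
  rw [this]
  exact isClosed_iInter fun i => isClosed_Icc.preimage (by fun_prop)

lemma norm_le_sqrt_mul {x : EuclideanSpace ℝ (Fin p)} {r : ℝ} (hr : 0 ≤ r)
    (h : ∀ i, |x i| ≤ r) : ‖x‖ ≤ Real.sqrt p * r := by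
  rw [EuclideanSpace.norm_eq, Real.sqrt_le_left (by positivity), mul_pow,
    Real.sq_sqrt (by positivity)]
  calc ∑ i, ‖x i‖ ^ 2 ≤ ∑ _i : Fin p, r ^ 2 :=
        Finset.sum_le_sum fun i _ => by rw [Real.norm_eq_abs]; gcongr; exact h i
    _ = p * r ^ 2 := by simp

lemma norm_sub_le_of_mem_cube {M : ℝ} (hM : 0 ≤ M) {x y : EuclideanSpace ℝ (Fin p)}
    (hx : x ∈ cube p M) (hy : y ∈ cube p M) : ‖x - y‖ ≤ Real.sqrt p * (2 * M) :=
  norm_le_sqrt_mul (by positivity) fun i => by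
    have h1 := hx i
    have h2 := hy i
    rw [Set.mem_Icc] at h1 h2
    rw [PiLp.sub_apply, abs_le]
    constructor <;> linarith

variable {M H : ℝ}
  (hφd : Differentiable ℝ φ) (hφc : ConvexOn ℝ Set.univ φ)
  (hH : ∀ x ∈ cube p M, ∀ y ∈ cube p M, ‖gradient φ x - gradient φ y‖ ≤ H * ‖x - y‖)

include hH in
lemma abs_inner_gradient_sub_le {x y : EuclideanSpace ℝ (Fin p)} (hx : x ∈ cube p M)
    (hy : y ∈ cube p M) (v : EuclideanSpace ℝ (Fin p)) :
    |inner ℝ (gradient φ x - gradient φ y) v| ≤ H * ‖x - y‖ * ‖v‖ :=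
  (abs_real_inner_le_norm _ _).trans (by gcongr; exact hH x hx y hy)

include hφd hφc hH in
-- By convexity the divergence is at most its symmetrization, an inner product of the gradient
-- difference with `x - y`.
lemma bregman_le_mul_norm_sq {x y : EuclideanSpace ℝ (Fin p)} (hx : x ∈ cube p M)
    (hy : y ∈ cube p M) : bregman φ x y ≤ H * ‖x - y‖ ^ 2 := by
  have h1 := bregman_add_bregman_comm (φ := φ) x y
  have h2 := bregman_nonneg hφd hφc y x
  have h3 := le_of_abs_le (abs_inner_gradient_sub_le hH hx hy (x - y))
  linarith

include hφd hφc hH in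
/-- The three-points identity at the midpoint improves the constant of
`bregman_le_mul_norm_sq`. -/
lemma bregman_le_three_quarters_mul_norm_sq {x y : EuclideanSpace ℝ (Fin p)} (hx : x ∈ cube p M)
    (hy : y ∈ cube p M) : bregman φ x y ≤ 3 / 4 * H * ‖x - y‖ ^ 2 := by
  have hz : midpoint ℝ x y ∈ cube p M := (convex_cube M).midpoint_mem hx hy
  have e1 : ‖x - midpoint ℝ x y‖ = ‖x - y‖ / 2 := by
    rw [← dist_eq_norm, dist_left_midpoint, dist_eq_norm, Real.norm_ofNat]; ring
  have e2 : ‖midpoint ℝ x y - y‖ = ‖x - y‖ / 2 := by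
    rw [← dist_eq_norm, dist_midpoint_right, dist_eq_norm, Real.norm_ofNat]; ring
  have h1 := bregman_le_mul_norm_sq hφd hφc hH hx hz
  have h2 := bregman_le_mul_norm_sq hφd hφc hH hz hy
  have h3 := le_of_abs_le (abs_inner_gradient_sub_le hH hz hy (x - midpoint ℝ x y))
  -- Each of the three terms is at most `H‖x - y‖²/4`.
  rw [bregman_three_points x (midpoint ℝ x y) y]
  rw [e1] at h1
  rw [e2] at h2
  rw [e1, e2] at h3
  linarith

include hφd hφc hH in
-- By the three-points identity the difference is `bregman φ z y` plus a gradient term; each is at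
-- most `H‖y - z‖` times the diameter `2M√p` of the cube.
lemma abs_bregman_sub_le (hH0 : 0 ≤ H) (hM : 0 ≤ M) {x y z : EuclideanSpace ℝ (Fin p)}
    (hx : x ∈ cube p M) (hy : y ∈ cube p M) (hz : z ∈ cube p M) :
    |bregman φ x y - bregman φ x z| ≤ 4 * H * M * Real.sqrt p * ‖y - z‖ := by
  have h1 := bregman_le_mul_norm_sq hφd hφc hH hz hy
  have h1' := bregman_nonneg hφd hφc z y
  have h2 := abs_inner_gradient_sub_le hH hz hy (x - z)
  have h3 : H * ‖y - z‖ * ‖y - z‖ ≤ H * ‖y - z‖ * (Real.sqrt p * (2 * M)) := by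
    gcongr; exact norm_sub_le_of_mem_cube hM hy hz
  have h4 : H * ‖y - z‖ * ‖x - z‖ ≤ H * ‖y - z‖ * (Real.sqrt p * (2 * M)) := by
    gcongr; exact norm_sub_le_of_mem_cube hM hx hz
  rw [norm_sub_rev z y] at h1 h2
  rw [bregman_three_points x z y]
  rw [abs_le] at h2 ⊢
  constructor <;> linarith [h2.1, h2.2]

end Bregman

/-! ### Range, regularity and Lipschitz dependence of the loss. -/

section Loss

variable {p k : ℕ} {φ : EuclideanSpace ℝ (Fin p) → ℝ} {Ψ : (Fin k → ℝ) → ℝ} {M H τ : ℝ}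
  (hφd : Differentiable ℝ φ) (hφc : ConvexOn ℝ Set.univ φ) (hΨ : IsAggregator Ψ)
  (hτ : ∀ x y : Fin k → ℝ, 0 ≤ x → 0 ≤ y → |Ψ x - Ψ y| ≤ τ * ∑ j, |x j - y j|)
  (hH : ∀ x ∈ cube p M, ∀ y ∈ cube p M, ‖gradient φ x - gradient φ y‖ ≤ H * ‖x - y‖)

include hφd hφc hτ in
-- `Ψ` may be arbitrary off the orthant, so continuity of a composition does not apply directly;
-- nonnegativity of the divergences keeps its arguments where the Lipschitz bound holds. The
-- gradient enters only at the fixed centroids, so it need not be continuous.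
lemma continuous_loss (Θ : Fin k → EuclideanSpace ℝ (Fin p)) : Continuous (loss φ Ψ Θ) := by
  have hb (j : Fin k) : Continuous fun x => bregman φ x (Θ j) := by
    have := hφd.continuous
    unfold bregman
    fun_prop
  rw [continuous_iff_continuousAt]
  intro x
  rw [ContinuousAt, tendsto_iff_dist_tendsto_zero]
  have hlim : Filter.Tendsto
      (fun y => τ * ∑ j, |bregman φ y (Θ j) - bregman φ x (Θ j)|) (nhds x) (nhds 0) := by
    have : Continuous fun y => τ * ∑ j, |bregman φ y (Θ j) - bregman φ x (Θ j)| := by fun_prop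
    simpa using this.tendsto x
  exact squeeze_zero (fun _ => dist_nonneg) (fun y => hτ _ _
    (fun j => bregman_nonneg hφd hφc _ _) (fun j => bregman_nonneg hφd hφc _ _)) hlim

include hτ in
lemma lipschitz_const_nonneg (hk : 0 < k) : 0 ≤ τ := by
  have h := (abs_nonneg _).trans (hτ (fun _ => 1) 0 (fun _ => zero_le_one) le_rfl)
  have hk' : (0 : ℝ) < k := by positivity
  simp at h
  nlinarith

include hφd hφc hΨ hτ hH in
lemma loss_mem_Icc (hH0 : 0 ≤ H) (hM : 0 ≤ M) (hτ0 : 0 ≤ τ)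
    {Θ : Fin k → EuclideanSpace ℝ (Fin p)} (hΘ : ∀ j, Θ j ∈ cube p M)
    {x : EuclideanSpace ℝ (Fin p)} (hx : x ∈ cube p M) :
    loss φ Ψ Θ x ∈ Set.Icc 0 (3 / 4 * (4 * τ * H * M ^ 2 * p * k)) := by
  have hb : (0 : Fin k → ℝ) ≤ fun j => bregman φ x (Θ j) :=
    fun j => bregman_nonneg hφd hφc _ _
  refine ⟨hΨ.nonneg _ hb, ?_⟩
  have h := hτ _ 0 hb le_rfl
  rw [hΨ.map_zero, sub_zero] at h
  refine (le_of_abs_le h).trans ?_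
  calc τ * ∑ j, |bregman φ x (Θ j) - (0 : Fin k → ℝ) j|
      ≤ τ * ∑ _j : Fin k, 3 * H * M ^ 2 * p := by
        gcongr with j
        rw [Pi.zero_apply, sub_zero, abs_of_nonneg (hb j)]
        refine (bregman_le_three_quarters_mul_norm_sq hφd hφc hH hx (hΘ j)).trans ?_
        calc 3 / 4 * H * ‖x - Θ j‖ ^ 2 ≤ 3 / 4 * H * (Real.sqrt p * (2 * M)) ^ 2 := by
              gcongr; exact norm_sub_le_of_mem_cube hM hx (hΘ j)
          _ = 3 * H * M ^ 2 * p := by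
              rw [mul_pow, Real.sq_sqrt (by positivity)]; ring
    _ = _ := by simp; ring

include hφd hφc hτ hH in
lemma abs_loss_sub_le (hH0 : 0 ≤ H) (hM : 0 ≤ M) (hτ0 : 0 ≤ τ)
    {Θ Θ' : Fin k → EuclideanSpace ℝ (Fin p)} (hΘ : ∀ j, Θ j ∈ cube p M)
    (hΘ' : ∀ j, Θ' j ∈ cube p M) {r : ℝ} (hr0 : 0 ≤ r) (hr : ∀ j i, |Θ j i - Θ' j i| ≤ M * r)
    {x : EuclideanSpace ℝ (Fin p)} (hx : x ∈ cube p M) :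
    |loss φ Ψ Θ x - loss φ Ψ Θ' x| ≤ 4 * τ * H * M ^ 2 * p * k * r := by
  refine (hτ _ _ (fun j => bregman_nonneg hφd hφc _ _)
    (fun j => bregman_nonneg hφd hφc _ _)).trans ?_
  calc τ * ∑ j, |bregman φ x (Θ j) - bregman φ x (Θ' j)|
      ≤ τ * ∑ _j : Fin k, 4 * H * M ^ 2 * p * r := by
        gcongr with j
        refine (abs_bregman_sub_le hφd hφc hH hH0 hM hx (hΘ j) (hΘ' j)).trans ?_
        calc _ ≤ 4 * H * M * Real.sqrt p * (Real.sqrt p * (M * r)) := by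
              gcongr; exact norm_le_sqrt_mul (by positivity) (hr j)
          _ = 4 * H * M ^ 2 * (Real.sqrt p * Real.sqrt p) * r := by ring
          _ = _ := by rw [Real.mul_self_sqrt (by positivity)]
    _ = _ := by simp; ring

end Loss

/-! ### Empirical integrals, parametrization of the centroids, and constants. -/

lemma integral_empirical {E : Type*} [MeasurableSpace E] {n : ℕ} {x : Fin n → E} {f : E → ℝ}
    (hf : StronglyMeasurable f) :
    ∫ y, f y ∂(empirical x) = (n : ℝ)⁻¹ * ∑ i, f (x i) := by
  rw [empirical, integral_smul_measure, integral_finsetSum_measure]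
  · simp [integral_dirac' _ _ hf]
  · intro i _
    exact integrable_dirac' hf (by simp)

/-- There are either no centroids or only one point in the space. This case is kept apart because
`τ` may be negative when `k = 0`, and `M` when `p = 0`. -/
lemma loss_eq_zero_of_mul_eq_zero {p k : ℕ} (h : k * p = 0)
    {φ : EuclideanSpace ℝ (Fin p) → ℝ} {Ψ : (Fin k → ℝ) → ℝ} (hΨ : IsAggregator Ψ)
    (Θ : Fin k → EuclideanSpace ℝ (Fin p)) : loss φ Ψ Θ = 0 := by
  ext x
  have : (fun j => bregman φ x (Θ j)) = 0 := by
    ext j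
    rcases Nat.mul_eq_zero.1 h with rfl | rfl
    · exact j.elim0
    · simp [bregman, Subsingleton.elim x (Θ j)]
  rw [loss, this, hΨ.map_zero, Pi.zero_apply]

/-- The centroids `M • u` with parameter vector `u`. -/
noncomputable def centroids {p k : ℕ} (M : ℝ) (u : Fin k × Fin p → ℝ) (j : Fin k) :
    EuclideanSpace ℝ (Fin p) :=
  WithLp.toLp 2 fun i => M * u (j, i)

lemma centroids_mem_cube {p k : ℕ} {M : ℝ} (hM : 0 ≤ M) {u : Fin k × Fin p → ℝ}
    (hu : ∀ z, |u z| ≤ 1) (j : Fin k) : centroids M u j ∈ cube p M := by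
  intro i
  have h := abs_le.1 (hu (j, i))
  simp only [centroids, Set.mem_Icc]
  constructor <;> nlinarith

lemma exists_centroids_eq {p k : ℕ} {M : ℝ} (hM : 0 ≤ M) {Θ : Fin k → EuclideanSpace ℝ (Fin p)}
    (hΘ : ∀ j, Θ j ∈ cube p M) :
    ∃ u : Fin k × Fin p → ℝ, (∀ z, |u z| ≤ 1) ∧ centroids M u = Θ := by
  have h (z : Fin k × Fin p) : |Θ z.1 z.2| ≤ M := abs_le.2 (hΘ z.1 z.2)
  -- For `M = 0` division by zero gives `u = 0`, which is correct because the cube is then the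
  -- origin.
  refine ⟨fun z => Θ z.1 z.2 / M, fun z => ?_, ?_⟩
  · rw [abs_div, abs_of_nonneg hM]
    exact div_le_one_of_le₀ (h z) hM
  · ext j i
    rcases hM.eq_or_lt with rfl | hM
    · simpa [centroids, eq_comm] using h (j, i)
    · simp [centroids, mul_div_cancel₀ _ hM.ne']

/-- The first term on the left is `16 τHM²(kp)^(3/2) n^(-1/2)`, and `16 ≤ 96√π`. -/
lemma chaining_bound_le {τ H M k p n l : ℝ} (hτ : 0 ≤ τ) (hH : 0 ≤ H) (hk : 0 ≤ k) (hp : 0 ≤ p)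
    (hn : 0 < n) :
    4 * (4 * τ * H * M ^ 2 * p * k) * Real.sqrt (k * p / n) +
        4 * τ * H * M ^ 2 * p * k * Real.sqrt (l / (2 * n)) ≤
      96 * Real.sqrt Real.pi * τ * H * M ^ 2 * (k * p) ^ (3 / 2 : ℝ) * n ^ (-(1 / 2) : ℝ) +
        4 * τ * H * M ^ 2 * p * k * Real.sqrt (l / (2 * n)) := by
  have h1 : (k * p) ^ (3 / 2 : ℝ) = k * p * Real.sqrt (k * p) := by
    rw [Real.sqrt_eq_rpow, show (3 / 2 : ℝ) = 1 + 1 / 2 by norm_num,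
      Real.rpow_add_of_nonneg (by positivity) (by norm_num) (by norm_num), Real.rpow_one]
  have h2 : n ^ (-(1 / 2) : ℝ) = (Real.sqrt n)⁻¹ := by
    rw [Real.rpow_neg hn.le, Real.sqrt_eq_rpow]
  have h3 : 1 ≤ Real.sqrt Real.pi := Real.one_le_sqrt.2 (by linarith [Real.pi_gt_three])
  have h4 : 0 ≤ τ * H * M ^ 2 * (k * p * Real.sqrt (k * p)) * (Real.sqrt n)⁻¹ := by positivity
  rw [h1, h2, Real.sqrt_div (by positivity)]
  have h5 := mul_le_mul_of_nonneg_right h3 h4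
  have h6 : 4 * (4 * τ * H * M ^ 2 * p * k) * (Real.sqrt (k * p) / Real.sqrt n) =
      16 * (τ * H * M ^ 2 * (k * p * Real.sqrt (k * p)) * (Real.sqrt n)⁻¹) := by ring
  linarith

end CenterClustering

/-! ### The uniform concentration theorem. -/

open CenterClustering in
theorem mainTheorem3
    {p k q n : ℕ} (hn : 0 < n) (M : ℝ)
    -- the convex differentiable generator of the Bregman divergence
    (φ : EuclideanSpace ℝ (Fin p) → ℝ)
    (hφd : Differentiable ℝ φ) (hφc : ConvexOn ℝ Set.univ φ)
    -- the aggregating functions, indexed by the hyperparameter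
    (A : Set (Fin q → ℝ)) (Ψ : (Fin q → ℝ) → (Fin k → ℝ) → ℝ)
    (hΨ : ∀ α ∈ A, CenterClustering.IsAggregator (Ψ α))
    -- A1: i.i.d. data from a distribution on the cube
    {Ω : Type*} [MeasurableSpace Ω] (μ : Measure Ω) [IsProbabilityMeasure μ]
    (P : Measure (EuclideanSpace ℝ (Fin p))) (hP : P ∈ CenterClustering.cubeMeasures p M)
    (X : Fin n → Ω → EuclideanSpace ℝ (Fin p))
    (hXm : ∀ i, Measurable (X i)) (hXind : iIndepFun X μ) (hXlaw : ∀ i, μ.map (X i) = P)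
    -- A2: the Lipschitz condition on the aggregating functions
    (τ : (Fin q → ℝ) → ℝ)
    (hτ : ∀ α ∈ A, ∀ x y : Fin k → ℝ, 0 ≤ x → 0 ≤ y →
      |Ψ α x - Ψ α y| ≤ τ α * ∑ j, |x j - y j|)
    -- A3: the Lipschitz condition on the gradient, on the cube
    (H : ℝ) (hH0 : 0 ≤ H)
    (hH : ∀ x ∈ CenterClustering.cube p M, ∀ y ∈ CenterClustering.cube p M,
      ‖gradient φ x - gradient φ y‖ ≤ H * ‖x - y‖)
    (α : Fin q → ℝ) (hα : α ∈ A) (δ : ℝ) (hδ0 : 0 < δ) (hδ1 : δ ≤ 1) :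
    (∀ f ∈ CenterClustering.lossClass φ (Ψ α) M, Integrable f P) ∧
    ENNReal.ofReal (1 - δ) ≤
      μ {ω | CenterClustering.classDist (CenterClustering.lossClass φ (Ψ α) M)
              (CenterClustering.empirical (fun i => X i ω)) P
            ≤ ENNReal.ofReal
              (96 * Real.sqrt Real.pi * τ α * H * M ^ 2 * ((k : ℝ) * (p : ℝ)) ^ (3 / 2 : ℝ)
                  * (n : ℝ) ^ (-(1 / 2) : ℝ)
                + 4 * τ α * H * M ^ 2 * (p : ℝ) * (k : ℝ)
                  * Real.sqrt (Real.log (2 / δ) / (2 * (n : ℝ))))} := by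
  obtain ⟨hPprob, hPcube⟩ := hP
  have hΨα := hΨ α hα
  have hτα := hτ α hα
  rcases Nat.eq_zero_or_pos (k * p) with hD | hD
  · have hzero : ∀ f ∈ lossClass φ (Ψ α) M, f = 0 := by
      rintro f ⟨Θ, -, rfl⟩
      exact loss_eq_zero_of_mul_eq_zero hD hΨα Θ
    refine ⟨fun f hf => by rw [hzero f hf]; exact integrable_zero _ _ _, ?_⟩
    have hdist (ω : Ω) : classDist (lossClass φ (Ψ α) M) (empirical fun i => X i ω) P = 0 := by
      simp only [classDist, ENNReal.iSup_eq_zero]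
      intro f hf
      simp [hzero f hf]
    simp only [hdist, zero_le, Set.ofPred_true, measure_univ]
    exact ENNReal.ofReal_le_one.2 (by linarith)
  have hk : 0 < k := Nat.pos_of_mul_pos_right hD
  have hp : 0 < p := Nat.pos_of_mul_pos_left hD
  have hτ0 : 0 ≤ τ α := lipschitz_const_nonneg hτα hk
  have hM : 0 ≤ M := by
    obtain ⟨x, hx⟩ : (cube p M).Nonempty := nonempty_of_measure_ne_zero (μ := P) (by simp [hPcube])
    have h := hx ⟨0, hp⟩
    linarith [h.1, h.2]
  have hcube : MeasurableSet (cube p M) := (isClosed_cube M).measurableSet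
  have hPae : ∀ᵐ x ∂P, x ∈ cube p M := by
    rw [← prob_compl_eq_zero_iff hcube] at hPcube
    exact hPcube
  set B : ℝ := 4 * τ α * H * M ^ 2 * p * k with hB_def
  have hB : 0 ≤ B := by positivity
  refine ⟨?_, ?_⟩
  · rintro f ⟨Θ, hΘ, rfl⟩
    exact Integrable.of_mem_Icc 0 (3 / 4 * B)
      (continuous_loss hφd hφc hτα Θ).measurable.aemeasurable
      (hPae.mono fun x hx => loss_mem_Icc hφd hφc hΨα hτα hH hH0 hM hτ0 hΘ hx)
  have hne : Nonempty (Fin k × Fin p) := ⟨(⟨0, hk⟩, ⟨0, hp⟩)⟩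
  -- Chaining asks for bounds at every point of the space. Cutting the loss off outside the cube
  -- provides them, and almost surely changes neither the sample means nor the integrals.
  let F : (Fin k × Fin p → ℝ) → EuclideanSpace ℝ (Fin p) → ℝ :=
    fun u => (cube p M).indicator (loss φ (Ψ α) (centroids M u))
  obtain ⟨bad, hbad, hgood⟩ := exists_uniform_deviation_le (F := F) hn hXm hXind hXlaw hB
    (fun u => (continuous_loss hφd hφc hτα _).measurable.indicator hcube)
    (fun u hu y => by
      by_cases hy : y ∈ cube p M
      · simp only [F, Set.indicator_of_mem hy]
        exact loss_mem_Icc hφd hφc hΨα hτα hH hH0 hM hτ0 (centroids_mem_cube hM hu) hy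
      · simp only [F, Set.indicator_of_notMem hy]
        exact ⟨le_rfl, by positivity⟩)
    (fun u v hu hv r hr y => by
      have hr0 : 0 ≤ r := (abs_nonneg _).trans (hr hne.some)
      by_cases hy : y ∈ cube p M
      · simp only [F, Set.indicator_of_mem hy]
        refine abs_loss_sub_le hφd hφc hτα hH hH0 hM hτ0 (centroids_mem_cube hM hu)
          (centroids_mem_cube hM hv) hr0 (fun j i => ?_) hy
        simp only [centroids]
        rw [← mul_sub, abs_mul, abs_of_nonneg hM]
        exact mul_le_mul_of_nonneg_left (hr _) hM
      · simp only [F, Set.indicator_of_notMem hy, sub_zero, abs_zero]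
        positivity)
    hδ0 hδ1
  have hXae : ∀ᵐ ω ∂μ, ∀ i, X i ω ∈ cube p M := by
    rw [ae_all_iff]
    intro i
    rw [← hXlaw i] at hPae
    exact ae_of_ae_map (hXm i).aemeasurable hPae
  have hsub : badᶜ ≤ᵐ[μ] {ω | classDist (lossClass φ (Ψ α) M) (empirical (fun i => X i ω)) P
      ≤ ENNReal.ofReal (96 * Real.sqrt Real.pi * τ α * H * M ^ 2 *
          ((k : ℝ) * (p : ℝ)) ^ (3 / 2 : ℝ) * (n : ℝ) ^ (-(1 / 2) : ℝ)
        + B * Real.sqrt (Real.log (2 / δ) / (2 * (n : ℝ))))} := by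
    filter_upwards [hXae] with ω hω hωbad
    refine iSup₂_le ?_
    rintro f ⟨Θ, hΘ, rfl⟩
    obtain ⟨u, hu, rfl⟩ := exists_centroids_eq hM hΘ
    refine ENNReal.ofReal_le_ofReal ?_
    have h := hgood ω hωbad u hu
    have hdev : deviation P (fun i => X i ω) (F u) =
        ∫ x, loss φ (Ψ α) (centroids M u) x ∂(empirical fun i => X i ω) -
          ∫ x, loss φ (Ψ α) (centroids M u) x ∂P := by
      rw [integral_empirical (continuous_loss hφd hφc hτα _).stronglyMeasurable, deviation]
      congr 1
      · simp only [F, Set.indicator_of_mem (hω _)]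
      · exact integral_congr_ae (hPae.mono fun x hx => Set.indicator_of_mem hx _)
    rw [hdev, Fintype.card_prod, Fintype.card_fin, Fintype.card_fin, Nat.cast_mul] at h
    exact h.trans (chaining_bound_le hτ0 hH0 (by positivity) (by positivity) (by positivity))
  refine le_trans ?_ (measure_mono_ae hsub)
  -- Subadditivity alone suffices, so neither `bad` nor the event of the theorem has to be
  -- measurable.
  rw [ENNReal.ofReal_sub _ hδ0.le, ENNReal.ofReal_one, tsub_le_iff_right]
  calc (1 : ℝ≥0∞) = μ (badᶜ ∪ bad) := by rw [Set.compl_union_self, measure_univ]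
    _ ≤ μ badᶜ + μ bad := measure_union_le _ _
    _ ≤ μ badᶜ + ENNReal.ofReal δ := by gcongr
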